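/- Let $k$ be a field and let $q\in k$ be a nonzero element of infinite multiplicative order. Let $$\Lambda=\Lambda(q)=k\langle x,y,z\rangle/(x^{2},\,y^{2},\,z^{2},\,zy,\,yx+qxy,\,zx-xz,\,yz-xz),$$ and let $M(q)$ be the right $\Lambda$-module with $k$-basis $v,v',v''$ on which $vx=qv'$, $vy=v'$, $vz=v''$, and $v',v''$ are annihilated by $x$, $y$ and $z$. For a finitely generated right module $M$ over a finite-dimensional algebra $A$, the syzygy $\Omega M$ is the kernel of an epimorphism onto $M$ from a finitely generated projective module; it is well defined up to isomorphism in the stable module category, i.e. the category of finitely generated right modules modulo the morphisms that factor through a projective module. The delooping level $\operatorname{dell}M$ is the smallest integer $n\ge 0$ such that $\Omega^{n}M$ is a direct summand, in the stable module category, of $\Omega^{n+1}N$ for some finitely generated right $A$-module $N$, and is $\infty$ if no such $n$ exists. Then $\Lambda$ is a local algebra with $\dim_k\Lambda=6$; the module $M(q)$ is three-dimensional and semi-Gorenstein-projective, that is, $\operatorname{Ext}^{i}_\Lambda(M(q),\Lambda)=0$ for all $i\ge 1$; and $\operatorname{dell}M(q)=\infty$. -/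

import Mathlib

open CategoryTheory

universe u

namespace Delooping

/-! Right modules over a ring `A` are modules over the opposite ring `Aᵐᵒᵖ`, so that
`MulOpposite.op a • m` is the element usually written `m a`. -/

/-- The category of right `A`-modules. -/
abbrev RightMod (A : Type u) [Ring A] := ModuleCat.{u} Aᵐᵒᵖ

section General

variable {A : Type u} [Ring A]

/-- A homomorphism of right modules is stably zero if it factors through a finitely generated
projective module. -/
def StablyZero {X Y : RightMod A} (f : X →ₗ[Aᵐᵒᵖ] Y) : Prop :=
  ∃ (P : RightMod A) (a : X →ₗ[Aᵐᵒᵖ] P) (b : P →ₗ[Aᵐᵒᵖ] Y),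
    Module.Finite Aᵐᵒᵖ P ∧ Module.Projective Aᵐᵒᵖ P ∧ f = b ∘ₗ a

/-- `X` and `Y` are isomorphic in the stable module category, whose morphisms are the module
homomorphisms modulo the stably zero ones. -/
def StablyIso (X Y : RightMod A) : Prop :=
  ∃ (f : X →ₗ[Aᵐᵒᵖ] Y) (g : Y →ₗ[Aᵐᵒᵖ] X),
    StablyZero (g ∘ₗ f - LinearMap.id) ∧ StablyZero (f ∘ₗ g - LinearMap.id)

/-- `X` is a direct summand of `Y` in the stable category of finitely generated modules:
`X ⊕ Z` is stably isomorphic to `Y` for some finitely generated `Z`. -/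
def IsStableSummand (X Y : RightMod A) : Prop :=
  ∃ Z : RightMod A, Module.Finite Aᵐᵒᵖ Z ∧ StablyIso (ModuleCat.of Aᵐᵒᵖ (X × Z)) Y

/-- `K` is a first syzygy of `M`: the kernel of an epimorphism onto `M` from a finitely generated
projective module. In the stable category `K` is determined by `M`, and is denoted `Ω M`. -/
def IsSyzygy (M K : RightMod A) : Prop :=
  ∃ (P : RightMod A) (i : K →ₗ[Aᵐᵒᵖ] P) (p : P →ₗ[Aᵐᵒᵖ] M),
    Module.Finite Aᵐᵒᵖ P ∧ Module.Projective Aᵐᵒᵖ P ∧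
      Function.Injective i ∧ Function.Exact i p ∧ Function.Surjective p

/-- `K` is an `n`-th syzygy `Ω^n M` of `M`. -/
def IsNthSyzygy : ℕ → RightMod A → RightMod A → Prop
  | 0, M, K => Nonempty (M ≃ₗ[Aᵐᵒᵖ] K)
  | n + 1, M, K => ∃ L : RightMod A, IsNthSyzygy n M L ∧ IsSyzygy L K

/-- `Ω^n M` is a stable direct summand of `Ω^(n+1) N` for some finitely generated `N`.
As syzygies are unique up to stable isomorphism, it does not matter which ones are used. -/
def DeloopsAt (M : RightMod A) (n : ℕ) : Prop :=
  ∃ N K L : RightMod A, Module.Finite Aᵐᵒᵖ N ∧ IsNthSyzygy n M K ∧ IsNthSyzygy (n + 1) N L ∧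
    IsStableSummand K L

/-- The delooping level of `M` (used for finitely generated modules over a finite dimensional
algebra): the least `n` as in `DeloopsAt`, or `⊤` if there is none. -/
noncomputable def dell (M : RightMod A) : ℕ∞ :=
  ⨅ (n : ℕ) (_ : DeloopsAt M n), (n : ℕ∞)

/-- `M` is semi-Gorenstein-projective: `Ext^i(M, A) = 0` for all `i ≥ 1`. -/
def IsSemiGorensteinProjective (M : RightMod A) : Prop :=
  ∀ i : ℕ, 1 ≤ i → Subsingleton (Abelian.Ext.{u} M (ModuleCat.of Aᵐᵒᵖ A) i)

end General

/-- The names of the three generators. -/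
inductive Gen
  | x
  | y
  | z

/-- A generator, as an element of the free algebra `k⟨x, y, z⟩`. -/
abbrev gen (k : Type u) [Field k] (g : Gen) : FreeAlgebra k Gen := FreeAlgebra.ι k g

/-- The defining relations `x², y², z², zy, yx + q xy, zx - xz, yz - xz`. -/
inductive Rel (k : Type u) [Field k] (q : k) : FreeAlgebra k Gen → FreeAlgebra k Gen → Prop
  | xx : Rel k q (gen k .x * gen k .x) 0
  | yy : Rel k q (gen k .y * gen k .y) 0
  | zz : Rel k q (gen k .z * gen k .z) 0
  | zy : Rel k q (gen k .z * gen k .y) 0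
  | yx : Rel k q (gen k .y * gen k .x + q • (gen k .x * gen k .y)) 0
  | zx : Rel k q (gen k .z * gen k .x - gen k .x * gen k .z) 0
  | yz : Rel k q (gen k .y * gen k .z - gen k .x * gen k .z) 0

/-- The algebra `Λ(q) = k⟨x,y,z⟩/(x², y², z², zy, yx + q xy, zx - xz, yz - xz)`. -/
abbrev Lam (k : Type u) [Field k] (q : k) : Type u := RingQuot (Rel k q)

/-- The matrices by which the generators act from the right on row vectors, in the basis
`v, v', v''` of `M(α)`: `v x = α v'`, `v y = v'`, `v z = v''`, and `v', v''` are annihilated. -/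
def genMatrix {k : Type u} [Field k] (α : k) : Gen → Matrix (Fin 3) (Fin 3) k
  | .x => !![0, α, 0; 0, 0, 0; 0, 0, 0]
  | .y => !![0, 1, 0; 0, 0, 0; 0, 0, 0]
  | .z => !![0, 0, 1; 0, 0, 0; 0, 0, 0]

theorem genMatrix_mul {k : Type u} [Field k] (α : k) (g h : Gen) :
    genMatrix α g * genMatrix α h = 0 := by
  ext i j
  cases g <;> cases h <;> fin_cases i <;> fin_cases j <;>
    simp [genMatrix, Matrix.mul_apply, Fin.sum_univ_three]

/-- The matrix representation of `Λ(q)` that defines `M(α)`. -/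
noncomputable def rep (k : Type u) [Field k] (q α : k) :
    Lam k q →ₐ[k] Matrix (Fin 3) (Fin 3) k :=
  RingQuot.liftAlgHom k ⟨FreeAlgebra.lift k (genMatrix α), by
    intro a b h
    cases h <;> simp [genMatrix_mul]⟩

/-- The underlying space of `M(α)`: row vectors in the basis `v, v', v''`. -/
def RZ (k : Type u) [Field k] (_q _α : k) : Type u := Fin 3 → k

section RZ

variable (k : Type u) [Field k] (q α : k)

instance : AddCommGroup (RZ k q α) := inferInstanceAs (AddCommGroup (Fin 3 → k))

instance : Module k (RZ k q α) := inferInstanceAs (Module k (Fin 3 → k))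

/-- The right `Λ(q)`-module structure of `M(α)`. -/
noncomputable instance : Module (Lam k q)ᵐᵒᵖ (RZ k q α) where
  smul a v := Matrix.vecMul (show Fin 3 → k from v) (rep k q α a.unop)
  one_smul v := by
    change Matrix.vecMul _ (rep k q α 1) = _
    rw [map_one]; exact Matrix.vecMul_one _
  mul_smul a b v := by
    change Matrix.vecMul _ (rep k q α (b.unop * a.unop)) = Matrix.vecMul (Matrix.vecMul _ _) _
    rw [map_mul, Matrix.vecMul_vecMul]
  smul_zero a := Matrix.zero_vecMul _
  smul_add a v w := Matrix.add_vecMul _ _ _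
  add_smul a b v := by
    change Matrix.vecMul _ (rep k q α (a.unop + b.unop)) = _
    rw [map_add]; exact Matrix.vecMul_add _ _ _
  zero_smul v := by
    change Matrix.vecMul _ (rep k q α 0) = _
    rw [map_zero]; exact Matrix.vecMul_zero _

/-- The right `Λ(q)`-module `M(α)`. -/
noncomputable abbrev modM : RightMod (Lam k q) := ModuleCat.of (Lam k q)ᵐᵒᵖ (RZ k q α)

end RZ

end Delooping

/-! The elements x - αy satisfy (x - αy)(x - qαy) = 0 and (x - αy)z = (1 - α)zx. The left
annihilator of x - qαy is Λ(x - αy) (`Lam.exists_eq_mul_xy`); if α, qα ≠ 1, the right annihilator of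
x - αy is (x - qαy)Λ (`Lam.exists_eq_xy_mul`). Ext: for such α, M(α) = Λ/(x - αy)Λ has syzygy M(qα),
and the left annihilator makes every map (x - αy)Λ → Λ extend to Λ, so Ext¹ vanishes. No positive
power of q is 1, so dimension shifting along M(q), M(q²), ... kills all Ext. Delooping: consider,
for a module X, the condition that l(x - qⁿ⁺¹y) = 0 implies lz ∈ Xx. Every (n+1)-st syzygy satisfies
it, because the factor 1 - α vanishes at α = 1 (`exists_z_smul_eq_of_syzygy`). No n-th syzygy of
M(q) does, because the factors 1 - qⁱ with i ≥ 1 are invertible (`exists_z_smul_ne_of_syzygy`). The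
condition passes to stable summands, so no n deloops. -/

namespace Delooping

/-! ### Structure of Λ: basis, dimension, locality -/

section Algebra

variable {k : Type u} [Field k] {q : k}

/-- The class of a generator in `Λ(q)`. -/
noncomputable def Lam.g (q : k) (a : Gen) : Lam k q := RingQuot.mkAlgHom k (Rel k q) (gen k a)

theorem Lam.rel {a b : FreeAlgebra k Gen} (h : Rel k q a b) :
    RingQuot.mkAlgHom k (Rel k q) a = RingQuot.mkAlgHom k (Rel k q) b :=
  RingQuot.mkAlgHom_rel k h


theorem Lam.xx : Lam.g q .x * Lam.g q .x = 0 := by simpa [Lam.g] using Lam.rel (Rel.xx (q := q))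
theorem Lam.yy : Lam.g q .y * Lam.g q .y = 0 := by simpa [Lam.g] using Lam.rel (Rel.yy (q := q))
theorem Lam.zz : Lam.g q .z * Lam.g q .z = 0 := by simpa [Lam.g] using Lam.rel (Rel.zz (q := q))
theorem Lam.zy : Lam.g q .z * Lam.g q .y = 0 := by simpa [Lam.g] using Lam.rel (Rel.zy (q := q))
theorem Lam.yx : Lam.g q .y * Lam.g q .x = (-q) • (Lam.g q .x * Lam.g q .y) := by
  have := Lam.rel (Rel.yx (q := q))
  simp only [map_add, map_mul, map_smul, map_zero] at this
  change Lam.g q .y * Lam.g q .x + q • (Lam.g q .x * Lam.g q .y) = 0 at this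
  rw [← zero_add ((-q) • _), ← this, add_assoc, ← add_smul, add_neg_cancel, zero_smul, add_zero]
theorem Lam.zx : Lam.g q .z * Lam.g q .x = Lam.g q .x * Lam.g q .z := by
  have := Lam.rel (Rel.zx (q := q))
  simp only [map_sub, map_mul, map_zero] at this
  exact sub_eq_zero.mp this
theorem Lam.yz : Lam.g q .y * Lam.g q .z = Lam.g q .x * Lam.g q .z := by
  have := Lam.rel (Rel.yz (q := q))
  simp only [map_sub, map_mul, map_zero] at this
  exact sub_eq_zero.mp this

/-- The element of `Λ(q)` with given coordinates with respect to `1, x, y, z, xy, xz`. -/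
noncomputable def Lam.mk (q : k) (c : Fin 6 → k) : Lam k q :=
  c 0 • 1 + c 1 • Lam.g q .x + c 2 • Lam.g q .y + c 3 • Lam.g q .z +
    c 4 • (Lam.g q .x * Lam.g q .y) + c 5 • (Lam.g q .x * Lam.g q .z)

/-- The matrix of right multiplication by the element with coordinates `c`. -/
def regMatrix (q : k) (c : Fin 6 → k) : Matrix (Fin 6) (Fin 6) k :=
  !![c 0, c 1, c 2, c 3, c 4, c 5;
     0, c 0, 0, 0, c 2, c 3;
     0, 0, c 0, 0, -q * c 1, c 3;
     0, 0, 0, c 0, 0, c 1;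
     0, 0, 0, 0, c 0, 0;
     0, 0, 0, 0, 0, c 0]

/-- The coordinates of the generators. -/
def genCoord : Gen → Fin 6 → k
  | .x => ![0, 1, 0, 0, 0, 0]
  | .y => ![0, 0, 1, 0, 0, 0]
  | .z => ![0, 0, 0, 1, 0, 0]

/-- Coordinates of the product of two elements. -/
def mulCoord (q : k) (a b : Fin 6 → k) : Fin 6 → k :=
  ![a 0 * b 0, a 0 * b 1 + a 1 * b 0, a 0 * b 2 + a 2 * b 0, a 0 * b 3 + a 3 * b 0,
    a 0 * b 4 + a 4 * b 0 + a 1 * b 2 - q * (a 2 * b 1),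
    a 0 * b 5 + a 5 * b 0 + a 1 * b 3 + a 2 * b 3 + a 3 * b 1]

theorem regMatrix_mul (a b : Fin 6 → k) :
    regMatrix q a * regMatrix q b = regMatrix q (mulCoord q a b) := by
  ext i j
  fin_cases i <;> fin_cases j <;>
    simp [regMatrix, mulCoord, Matrix.mul_apply, Fin.sum_univ_succ] <;> ring

theorem regMatrix_zero : regMatrix q 0 = 0 := by
  ext i j
  fin_cases i <;> fin_cases j <;> simp [regMatrix]

theorem regMatrix_add (a b : Fin 6 → k) :
    regMatrix q (a + b) = regMatrix q a + regMatrix q b := by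
  ext i j
  fin_cases i <;> fin_cases j <;> simp [regMatrix] <;> ring

theorem regMatrix_smul (r : k) (a : Fin 6 → k) :
    regMatrix q (r • a) = r • regMatrix q a := by
  ext i j
  fin_cases i <;> fin_cases j <;> simp [regMatrix] <;> ring

theorem regMatrix_one : regMatrix q (![1, 0, 0, 0, 0, 0]) = 1 := by
  ext i j
  fin_cases i <;> fin_cases j <;> simp [regMatrix]

theorem regMatrix_row (c : Fin 6 → k) : (regMatrix q c) 0 = c := by
  ext j
  fin_cases j <;> simp [regMatrix]

/-- The right regular representation, in coordinates. -/
noncomputable def reg (q : k) : Lam k q →ₐ[k] Matrix (Fin 6) (Fin 6) k :=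
  RingQuot.liftAlgHom k ⟨FreeAlgebra.lift k fun a => regMatrix q (genCoord a), by
    intro a b h
    cases h <;> simp only [map_add, map_sub, map_mul, map_smul, map_zero, FreeAlgebra.lift_ι_apply,
      regMatrix_mul, ← regMatrix_add, ← regMatrix_smul] <;>
      first | rw [sub_eq_zero] | rw [← regMatrix_zero (q := q)]
    all_goals
      refine congrArg _ (funext fun i => ?_) <;> fin_cases i <;> simp [mulCoord, genCoord]⟩

theorem reg_g (a : Gen) : reg q (Lam.g q a) = regMatrix q (genCoord a) := by
  simp [reg, Lam.g]

/-- The coordinates of an element of `Λ(q)`. -/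
noncomputable def Lam.coord (u : Lam k q) : Fin 6 → k := reg q u 0

theorem reg_mk (c : Fin 6 → k) : reg q (Lam.mk q c) = regMatrix q c := by
  simp only [Lam.mk, map_add, map_smul, map_mul, map_one, reg_g, regMatrix_mul,
    ← regMatrix_one (q := q), ← regMatrix_smul, ← regMatrix_add]
  congr 1
  ext i
  fin_cases i <;> simp [mulCoord, genCoord]

theorem Lam.coord_mk (c : Fin 6 → k) : (Lam.mk q c).coord = c := by
  rw [Lam.coord, reg_mk, regMatrix_row]

theorem Lam.mk_mul_g (a : Gen) (c : Fin 6 → k) :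
    Lam.mk q c * Lam.g q a = Lam.mk q (mulCoord q c (genCoord a)) := by
  have hy : ∀ w : Lam k q,
      Lam.g q .x * Lam.g q .y * w = Lam.g q .x * (Lam.g q .y * w) := fun w => mul_assoc _ _ _
  have hz : ∀ w : Lam k q,
      Lam.g q .x * Lam.g q .z * w = Lam.g q .x * (Lam.g q .z * w) := fun w => mul_assoc _ _ _
  have hx : ∀ w : Lam k q, Lam.g q .x * (Lam.g q .x * w) = 0 := fun w => by
    rw [← mul_assoc, Lam.xx, zero_mul]
  have hyx : Lam.g q .x * ((-q) • (Lam.g q .x * Lam.g q .y)) = 0 := by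
    rw [mul_smul_comm, hx, smul_zero]
  cases a <;>
  simp [-neg_smul, Lam.mk, add_mul, mulCoord, genCoord, hx, hy, hz, hyx, Lam.xx, Lam.yy, Lam.zz,
    Lam.zy, Lam.yx, Lam.zx, Lam.yz, smul_smul] <;> module

/-- The span of the six monomials contains 1 and is stable under right multiplication by the
generators, so it is all of Λ. Their independence comes from `reg`. -/
theorem Lam.mk_surjective : Function.Surjective (Lam.mk q) := by
  have hadd : ∀ a b : Fin 6 → k, Lam.mk q a + Lam.mk q b = Lam.mk q (a + b) := by
    intro a b; simp only [Lam.mk, Pi.add_apply]; module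
  have hsmul : ∀ (r : k) (b : Fin 6 → k), r • Lam.mk q b = Lam.mk q (r • b) := by
    intro r b; simp only [Lam.mk, Pi.smul_apply, smul_eq_mul]; module
  have key : ∀ (w : FreeAlgebra k Gen) (c : Fin 6 → k),
      ∃ d, Lam.mk q c * RingQuot.mkAlgHom k (Rel k q) w = Lam.mk q d := by
    intro w
    induction w using FreeAlgebra.induction with
    | grade0 r =>
      intro c
      refine ⟨r • c, ?_⟩
      rw [AlgHom.commutes, ← Algebra.commutes, ← Algebra.smul_def, hsmul]
    | grade1 a => exact fun c => ⟨_, Lam.mk_mul_g a c⟩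
    | mul a b ha hb =>
      intro c
      obtain ⟨d, hd⟩ := ha c
      obtain ⟨e, he⟩ := hb d
      exact ⟨e, by rw [map_mul, ← mul_assoc, hd, he]⟩
    | add a b ha hb =>
      intro c
      obtain ⟨d, hd⟩ := ha c
      obtain ⟨e, he⟩ := hb c
      exact ⟨d + e, by rw [map_add, mul_add, hd, he, hadd]⟩
  intro u
  obtain ⟨w, rfl⟩ := RingQuot.mkAlgHom_surjective k (Rel k q) u
  obtain ⟨d, hd⟩ := key w (![1, 0, 0, 0, 0, 0])
  refine ⟨d, hd.symm.trans ?_⟩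
  simp [Lam.mk]

theorem Lam.mk_coord (u : Lam k q) : Lam.mk q u.coord = u := by
  obtain ⟨c, rfl⟩ := Lam.mk_surjective u
  rw [Lam.coord_mk]

theorem Lam.coord_injective : Function.Injective (Lam.coord (k := k) (q := q)) :=
  Function.LeftInverse.injective Lam.mk_coord

theorem Lam.reg_eq (u : Lam k q) : reg q u = regMatrix q u.coord := by
  conv_lhs => rw [← Lam.mk_coord u]
  exact reg_mk _

theorem Lam.coord_mul (u w : Lam k q) : (u * w).coord = mulCoord q u.coord w.coord := by
  rw [Lam.coord, map_mul, Lam.reg_eq, Lam.reg_eq, regMatrix_mul, regMatrix_row]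

theorem Lam.coord_add (u w : Lam k q) : (u + w).coord = u.coord + w.coord := by
  rw [Lam.coord, map_add]; rfl

theorem Lam.coord_sub (u w : Lam k q) : (u - w).coord = u.coord - w.coord := by
  rw [Lam.coord, map_sub]; rfl

theorem Lam.coord_smul (r : k) (u : Lam k q) : (r • u).coord = r • u.coord := by
  rw [Lam.coord, map_smul]; rfl

theorem Lam.coord_zero : (0 : Lam k q).coord = 0 := by
  rw [Lam.coord, map_zero]; rfl

theorem Lam.coord_one : (1 : Lam k q).coord = ![1, 0, 0, 0, 0, 0] := by
  rw [Lam.coord, map_one, ← regMatrix_one (q := q), regMatrix_row]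

theorem Lam.coord_g (a : Gen) : (Lam.g q a).coord = genCoord a := by
  rw [Lam.coord, reg_g, regMatrix_row]

/-- `Λ(q)` is six-dimensional: the coordinates as a linear equivalence. -/
noncomputable def Lam.coordEquiv : Lam k q ≃ₗ[k] (Fin 6 → k) where
  toFun := Lam.coord
  invFun := Lam.mk q
  map_add' := Lam.coord_add
  map_smul' := Lam.coord_smul
  left_inv := Lam.mk_coord
  right_inv := Lam.coord_mk

theorem Lam.finrank_eq : Module.finrank k (Lam k q) = 6 := by
  rw [Lam.coordEquiv.finrank_eq]; simp

theorem Lam.isUnit_of_coord_ne_zero {u : Lam k q} (h : u.coord 0 ≠ 0) : IsUnit u := by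
  have hn : IsNilpotent (u - algebraMap k _ (u.coord 0)) := by
    -- Every product of three generators vanishes in Λ.
    refine ⟨3, Lam.coord_injective ?_⟩
    ext i
    fin_cases i <;>
    simp [pow_succ, Lam.coord_mul, Algebra.algebraMap_eq_smul_one, Lam.coord_sub,
      Lam.coord_smul, Lam.coord_one, Lam.coord_zero, mulCoord]
  have hu : IsUnit (algebraMap k (Lam k q) (u.coord 0)) := (IsUnit.mk0 _ h).map _
  simpa using hn.isUnit_add_left_of_commute hu (Algebra.commutes _ _).symm

theorem Lam.isLocalRing : IsLocalRing (Lam k q) := by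
  have : Nontrivial (Lam k q) := by
    refine ⟨0, 1, fun h => ?_⟩
    have := congrFun (congrArg Lam.coord h) 0
    simp [Lam.coord_zero, Lam.coord_one] at this
  refine { isUnit_or_isUnit_of_add_one := fun {a b} h => ?_ }
  have := congrFun (congrArg Lam.coord h) 0
  simp only [Lam.coord_add, Lam.coord_one, Pi.add_apply, Matrix.cons_val_zero] at this
  by_cases ha : a.coord 0 = 0
  · right
    apply Lam.isUnit_of_coord_ne_zero
    rw [ha, zero_add] at this
    simp [this]
  · exact .inl (Lam.isUnit_of_coord_ne_zero ha)

/-! ### Annihilators of the elements x - αy -/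

/-- The element `x - α y` of `Λ(q)`. -/
noncomputable def Lam.xy (q α : k) : Lam k q := Lam.g q .x - α • Lam.g q .y

theorem Lam.coord_xy (α : k) : (Lam.xy q α).coord = ![0, 1, -α, 0, 0, 0] := by
  ext i
  fin_cases i <;> simp [Lam.xy, Lam.coord_sub, Lam.coord_smul, Lam.coord_g, genCoord]

theorem Lam.xy_mul_xy (α : k) : Lam.xy q α * Lam.xy q (q * α) = 0 := by
  apply Lam.coord_injective
  ext i
  fin_cases i <;> simp [Lam.coord_mul, Lam.coord_xy, mulCoord, Lam.coord_zero]

theorem Lam.xy_mul_z (α : k) : Lam.xy q α * Lam.g q .z = (1 - α) • (Lam.g q .z * Lam.g q .x) := by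
  rw [Lam.xy, sub_mul, smul_mul_assoc, Lam.yz, Lam.zx]; module

theorem Lam.exists_eq_mul_xy (hq0 : q ≠ 0) (α : k) {u : Lam k q}
    (h : u * Lam.xy q (q * α) = 0) : ∃ w, u = w * Lam.xy q α := by
  have h' := congrFun (congrArg Lam.coord h)
  have h1 := h' 1
  have h4 := h' 4
  have h5 := h' 5
  simp [Lam.coord_mul, Lam.coord_xy, mulCoord, Lam.coord_zero] at h1 h4 h5
  have h2 : u.coord 2 = -(α * u.coord 1) := by
    apply mul_left_cancel₀ hq0; linear_combination -h4
  -- Read off from y(x - αy) = -q xy and z(x - αy) = xz.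
  refine ⟨Lam.mk q ![u.coord 1, 0, -u.coord 4 * q⁻¹, u.coord 5, 0, 0], Lam.coord_injective ?_⟩
  ext i
  fin_cases i <;>
    simp [Lam.coord_mul, Lam.coord_xy, mulCoord, Lam.coord_mk, h1, h5, h2, mul_comm]
  field_simp

theorem Lam.exists_eq_xy_mul {α : k} (hα : α ≠ 1) (hα' : q * α ≠ 1) {u : Lam k q}
    (h : Lam.xy q α * u = 0) : ∃ w, u = Lam.xy q (q * α) * w := by
  have h' := congrFun (congrArg Lam.coord h)
  have h1 := h' 1
  have h4 := h' 4
  have h5 := h' 5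
  simp [Lam.coord_mul, Lam.coord_xy, mulCoord, Lam.coord_zero] at h1 h4 h5
  have h2 : u.coord 2 = -(q * α * u.coord 1) := by linear_combination h4
  have h3 : u.coord 3 = 0 := by
    apply mul_left_cancel₀ (sub_ne_zero.mpr hα.symm); linear_combination h5
  -- Read off from (x - qαy)y = xy and (x - qαy)z = (1 - qα)xz; the latter is where qα ≠ 1 enters.
  refine ⟨Lam.mk q ![u.coord 1, 0, u.coord 4, u.coord 5 * (1 - q * α)⁻¹, 0, 0],
    Lam.coord_injective ?_⟩
  ext i
  fin_cases i <;>
    simp [Lam.coord_mul, Lam.coord_xy, mulCoord, Lam.coord_mk, h1, h3, h2, mul_comm]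
  have := sub_ne_zero.mpr hα'.symm
  have h6 : 1 - α * q ≠ 0 := by rwa [mul_comm α q]
  field_simp
  ring

end Algebra
-- Infinite delooping level
open MulOpposite

/-- If the solutions in `R` of `r u = 0` are the multiples of `s`, then the same is true in every
projective module. -/
theorem exists_eq_smul_of_projective {R P : Type*} [Ring R] [AddCommGroup P] [Module R P]
    [Module.Projective R P] {r s : R} (h : ∀ u, r * u = 0 → ∃ w, u = s * w) {l : P}
    (hl : r • l = 0) : ∃ w, l = s • w := by
  classical
  obtain ⟨σ, hσ⟩ := Module.projective_def'.mp (inferInstance : Module.Projective R P)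
  have hc : ∀ i, ∃ w, σ l i = s * w := fun i => h _ <| by
    rw [← smul_eq_mul, ← Finsupp.smul_apply, ← map_smul, hl, map_zero, Finsupp.zero_apply]
  choose w hw using hc
  let W : P →₀ R := Finsupp.onFinset (σ l).support (fun i => if i ∈ (σ l).support then w i else 0)
    (fun i hi => by by_contra h; simp [h] at hi)
  have hW : σ l = s • W := by
    ext i
    by_cases hi : i ∈ (σ l).support
    · simp only [W, Finsupp.smul_apply, Finsupp.onFinset_apply, if_pos hi, smul_eq_mul, ← hw]
    · simp only [W, Finsupp.smul_apply, Finsupp.onFinset_apply, if_neg hi, smul_zero]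
      simpa using hi
  refine ⟨Finsupp.linearCombination R id W, ?_⟩
  rw [← map_smul, ← hW]
  exact (LinearMap.congr_fun hσ l).symm

section Right

variable {k : Type u} [Field k] {q : k}

theorem exists_eq_xy_smul (hq0 : q ≠ 0) {P : RightMod (Lam k q)}
    [Module.Projective (Lam k q)ᵐᵒᵖ P] (α : k) {l : P} (hl : op (Lam.xy q (q * α)) • l = 0) :
    ∃ w, l = op (Lam.xy q α) • w := by
  refine exists_eq_smul_of_projective (fun u hu => ?_) hl
  obtain ⟨w, hw⟩ := Lam.exists_eq_mul_xy hq0 α (u := u.unop) (congrArg unop hu)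
  exact ⟨op w, unop_injective hw⟩

theorem xy_smul_xy_smul {M : RightMod (Lam k q)} (α : k) (m : M) :
    op (Lam.xy q (q * α)) • op (Lam.xy q α) • m = 0 := by
  rw [smul_smul, ← op_mul, Lam.xy_mul_xy, op_zero, zero_smul]

theorem z_smul_xy_smul {M : RightMod (Lam k q)} (α : k) (m : M) :
    op (Lam.g q .z) • op (Lam.xy q α) • m =
      op (Lam.g q .x) • op (algebraMap k (Lam k q) (1 - α)) • op (Lam.g q .z) • m := by
  simp only [smul_smul, ← op_mul, Lam.xy_mul_z, Algebra.smul_def, ← mul_assoc, Algebra.commutes]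

theorem scalar_smul_comm {M : RightMod (Lam k q)} (r : k) (a : Lam k q) (m : M) :
    op (algebraMap k (Lam k q) r) • op a • m = op a • op (algebraMap k (Lam k q) r) • m := by
  simp only [smul_smul, ← op_mul, Algebra.commutes]

theorem x_smul_x_smul {M : RightMod (Lam k q)} (m : M) :
    op (Lam.g q .x) • op (Lam.g q .x) • m = 0 := by
  rw [smul_smul, ← op_mul, Lam.xx, op_zero, zero_smul]

theorem exists_eq_x_smul (hq0 : q ≠ 0) {P : RightMod (Lam k q)}
    [Module.Projective (Lam k q)ᵐᵒᵖ P] {l : P} (hl : op (Lam.g q .x) • l = 0) :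
    ∃ w, l = op (Lam.g q .x) • w := by
  have := exists_eq_xy_smul hq0 (P := P) 0 (l := l)
  simp only [mul_zero, Lam.xy, zero_smul, sub_zero] at this
  exact this hl

/-- In an `(n+1)`-st syzygy `L`, every solution `l` of `l x = q ^ (n + 1) l y` has `l z ∈ L x`. -/
theorem exists_z_smul_eq_of_syzygy (hq0 : q ≠ 0) {N : RightMod (Lam k q)} (n : ℕ)
    {L : RightMod (Lam k q)} (hL : IsNthSyzygy (n + 1) N L) {l : L}
    (hl : op (Lam.xy q (q ^ (n + 1))) • l = 0) :
    ∃ m : L, op (Lam.g q .z) • l = op (Lam.g q .x) • m := by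
  induction n generalizing L with
  | zero =>
    obtain ⟨L', -, P, i, p, -, hP, hi, -, -⟩ := hL
    obtain ⟨w, hw⟩ := exists_eq_xy_smul hq0 (P := P) 1 (l := i l)
      (by rw [zero_add, pow_one] at hl; rw [← map_smul, mul_one, hl, map_zero])
    -- Here l = w(x - y) in P, and (x - y)z = 0.
    refine ⟨0, hi ?_⟩
    rw [map_smul, hw, z_smul_xy_smul]
    simp
  | succ n ih =>
    obtain ⟨L', hL', P, i, p, -, hP, hi, hip, hp⟩ := hL
    obtain ⟨F, hF⟩ := exists_eq_xy_smul hq0 (P := P) (q ^ (n + 1)) (l := i l)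
      (by rw [← map_smul, ← pow_succ', hl, map_zero])
    have hpF : op (Lam.xy q (q ^ (n + 1))) • p F = 0 := by
      rw [← map_smul, ← hF, hip.apply_apply_eq_zero]
    obtain ⟨m, hm⟩ := ih hL' hpF
    obtain ⟨G, rfl⟩ := hp m
    obtain ⟨d, hd⟩ := (hip (op (Lam.g q .z) • F - op (Lam.g q .x) • G)).mp
      (by rw [map_sub, map_smul, map_smul, hm, sub_self])
    -- Since Fz = d + Gx and x² = 0, lz = (1 - qⁿ⁺¹)Fzx = (1 - qⁿ⁺¹)dx: the correction by G
    -- disappears.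
    refine ⟨op (algebraMap k (Lam k q) (1 - q ^ (n + 1))) • d, hi ?_⟩
    rw [map_smul, map_smul, map_smul, hF, z_smul_xy_smul, hd, smul_sub, smul_sub,
      scalar_smul_comm _ (Lam.g q .x), x_smul_x_smul, sub_zero]

theorem rep_g (α : k) (a : Gen) : rep k q α (Lam.g q a) = genMatrix α a := by
  simp [rep, Lam.g]

theorem RZ.op_smul (α : k) (a : Lam k q) (v : RZ k q α) :
    op a • v = (Matrix.vecMul (show Fin 3 → k from v) (rep k q α a) : Fin 3 → k) := rfl

/-- The generator of `M(α)`. -/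
def RZ.v (q α : k) : RZ k q α := (![1, 0, 0] : Fin 3 → k)

theorem RZ.xy_smul_v (α : k) : op (Lam.xy q α) • RZ.v q α = 0 := by
  rw [RZ.op_smul, Lam.xy, map_sub, map_smul, rep_g, rep_g]
  funext i
  fin_cases i <;> simp [RZ.v, genMatrix, Matrix.vecMul, dotProduct] <;> rfl

theorem RZ.z_smul_v_ne (α : k) (m : RZ k q α) :
    op (Lam.g q .z) • RZ.v q α ≠ op (Lam.g q .x) • m := by
  rw [RZ.op_smul, RZ.op_smul, rep_g, rep_g]
  intro h
  have := congrFun h 2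
  simp [RZ.v, genMatrix, Matrix.vecMul, dotProduct, Fin.sum_univ_three] at this

theorem pow_succ_ne_one (hq : ¬ IsOfFinOrder q) (n : ℕ) : q ^ (n + 1) ≠ 1 := fun h =>
  hq (isOfFinOrder_iff_pow_eq_one.mpr ⟨n + 1, n.succ_pos, h⟩)

/-- An `n`-th syzygy `K` of `M(q)` contains an element `l` with `l x = q ^ (n + 1) l y` and
`l z ∉ K x`. -/
theorem exists_z_smul_ne_of_syzygy (hq0 : q ≠ 0) (hq : ¬ IsOfFinOrder q) (n : ℕ)
    {K : RightMod (Lam k q)} (hK : IsNthSyzygy n (modM k q q) K) :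
    ∃ l : K, op (Lam.xy q (q ^ (n + 1))) • l = 0 ∧
      ∀ m : K, op (Lam.g q .z) • l ≠ op (Lam.g q .x) • m := by
  induction n generalizing K with
  | zero =>
    obtain ⟨e⟩ := hK
    refine ⟨e (RZ.v q q), ?_, fun m h => RZ.z_smul_v_ne (q := q) q (e.symm m) ?_⟩
    · rw [← map_smul, zero_add, pow_one, RZ.xy_smul_v, map_zero]
    · rw [← map_smul] at h
      rw [← map_smul e.symm, ← h, e.symm_apply_apply]
  | succ n ih =>
    obtain ⟨K', hK', P, i, p, -, hP, hi, hip, hp⟩ := hK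
    obtain ⟨l, hl, hlz⟩ := ih hK'
    obtain ⟨F, rfl⟩ := hp l
    obtain ⟨l', hl'⟩ := (hip (op (Lam.xy q (q ^ (n + 1))) • F)).mp (by rw [map_smul, hl])
    refine ⟨l', hi ?_, fun m hm => ?_⟩
    · rw [map_smul, hl', pow_succ' q (n + 1), xy_smul_xy_smul, map_zero]
    · have h := congrArg i hm
      have hne : (1 : k) - q ^ (n + 1) ≠ 0 := sub_ne_zero.mpr (pow_succ_ne_one hq n).symm
      rw [map_smul, map_smul, hl', z_smul_xy_smul, ← sub_eq_zero, ← smul_sub] at h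
      -- In a projective module only multiples of x are killed by x, so (1 - qⁿ⁺¹)Fz - m, with m
      -- viewed in P, is wx. Applying p kills m and puts lz in K'x.
      obtain ⟨w, hw⟩ := exists_eq_x_smul hq0 (P := P) h
      have h' := congrArg p hw
      rw [map_sub, hip.apply_apply_eq_zero, sub_zero, map_smul, map_smul, map_smul] at h'
      refine hlz (op (algebraMap k (Lam k q) (1 - q ^ (n + 1))⁻¹) • p w) ?_
      rw [← scalar_smul_comm, ← h', smul_smul, ← op_mul, ← map_mul, mul_inv_cancel₀ hne, map_one,
        op_one, one_smul]

/-- With gf - id = ba through a projective P, l'z = g(f(l')z) - b(a(l')z). The first term is a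
multiple of x by the syzygy condition on L; the second because a(l') = w(x - qⁿy) gives a(l')z = (1
- qⁿ)wzx. -/
theorem not_deloopsAt (hq0 : q ≠ 0) (hq : ¬ IsOfFinOrder q) (n : ℕ) :
    ¬ DeloopsAt (modM k q q) n := by
  rintro ⟨N, K, L, -, hK, hL, Z, -, f, g, ⟨P, a, b, -, hP, hab⟩, -⟩
  obtain ⟨l, hl, hlz⟩ := exists_z_smul_ne_of_syzygy hq0 hq n hK
  let l' : ModuleCat.of (Lam k q)ᵐᵒᵖ (K × Z) := ((l, 0) : K × Z)
  have hl' : op (Lam.xy q (q ^ (n + 1))) • l' = 0 := Prod.ext hl (smul_zero _)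
  obtain ⟨m, hm⟩ := exists_z_smul_eq_of_syzygy hq0 n hL (l := f l')
    (by rw [← map_smul, hl', map_zero])
  obtain ⟨w, hw⟩ := exists_eq_xy_smul hq0 (P := P) (q ^ n) (l := a l')
    (by rw [← map_smul, ← pow_succ', hl', map_zero])
  have h := congrArg (fun t => op (Lam.g q .z) • t) (LinearMap.congr_fun hab l')
  simp only [LinearMap.sub_apply, LinearMap.comp_apply, LinearMap.id_apply, smul_sub] at h
  rw [← map_smul, hm, ← map_smul b, hw, z_smul_xy_smul, map_smul, map_smul b, sub_eq_iff_eq_add,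
    ← sub_eq_iff_eq_add', ← smul_sub] at h
  exact hlz _ (congrArg Prod.fst h).symm

theorem dell_eq_top (hq0 : q ≠ 0) (hq : ¬ IsOfFinOrder q) : dell (modM k q q) = ⊤ := by
  simp [dell, not_deloopsAt hq0 hq]

end Right
-- Vanishing of Ext
open Abelian

/-- A ring, as a right module over itself, is projective. -/
theorem projective_right_self (A : Type u) [Ring A] : Module.Projective Aᵐᵒᵖ A :=
  Module.Projective.of_equiv'
    { MulOpposite.opAddEquiv.symm with
      map_smul' := fun _ _ => rfl : Aᵐᵒᵖ ≃ₗ[Aᵐᵒᵖ] A }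

section ShortExact

variable {C : Type*} [Category* C] [Abelian C] [HasExt.{u} C] {S : ShortComplex C}

theorem subsingleton_ext_succ_of_shortExact (hS : S.ShortExact) [Projective S.X₂] (Y : C) (n : ℕ)
    [Subsingleton (Ext.{u} S.X₁ Y n)] : Subsingleton (Ext.{u} S.X₃ Y (n + 1)) := by
  refine subsingleton_of_forall_eq 0 fun e => ?_
  obtain ⟨e', rfl⟩ := Ext.contravariant_sequence_exact₃ hS Y e (Ext.eq_zero_of_projective _)
    (add_comm 1 n)
  rw [Subsingleton.elim e' 0, Ext.comp_zero]

theorem subsingleton_ext_one_of_shortExact (hS : S.ShortExact) [Projective S.X₂] (Y : C)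
    (h : ∀ f : S.X₁ ⟶ Y, ∃ g : S.X₂ ⟶ Y, S.f ≫ g = f) : Subsingleton (Ext.{u} S.X₃ Y 1) := by
  refine subsingleton_of_forall_eq 0 fun e => ?_
  obtain ⟨e', rfl⟩ := Ext.contravariant_sequence_exact₃ hS Y e (Ext.eq_zero_of_projective _)
    (add_zero 1)
  obtain ⟨f, rfl⟩ := (Ext.mk₀_bijective _ _).2 e'
  obtain ⟨g, rfl⟩ := h f
  rw [← Ext.mk₀_comp_mk₀, ShortComplex.ShortExact.extClass_comp_assoc]

end ShortExact

variable {k : Type u} [Field k] {q : k}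

/-- `X` is isomorphic to `Λ(q) / (x - α y) Λ(q)`. -/
def IsPresentedBy (α : k) (X : RightMod (Lam k q)) : Prop :=
  ∃ p : Lam k q →ₗ[(Lam k q)ᵐᵒᵖ] X, Function.Surjective p ∧
    ∀ u, p u = 0 ↔ ∃ w, u = Lam.xy q α * w

theorem isPresentedBy_ker {α : k} (hα : α ≠ 1) (hα' : q * α ≠ 1) {X : RightMod (Lam k q)}
    {p : Lam k q →ₗ[(Lam k q)ᵐᵒᵖ] X} (hp : ∀ u, p u = 0 ↔ ∃ w, u = Lam.xy q α * w) :
    IsPresentedBy (q * α) (ModuleCat.of (Lam k q)ᵐᵒᵖ (LinearMap.ker p)) := by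
  let m : Lam k q →ₗ[(Lam k q)ᵐᵒᵖ] Lam k q :=
    { toFun := fun w => Lam.xy q α * w
      map_add' := mul_add _
      map_smul' := fun a w => (mul_assoc _ w a.unop).symm }
  refine ⟨m.codRestrict (LinearMap.ker p) fun w => (hp _).mpr ⟨w, rfl⟩, ?_, fun u => ?_⟩
  · rintro ⟨u, hu⟩
    obtain ⟨w, rfl⟩ := (hp u).mp hu
    exact ⟨w, rfl⟩
  · refine Subtype.ext_iff.trans ⟨fun h => Lam.exists_eq_xy_mul hα hα' h, ?_⟩
    rintro ⟨w, rfl⟩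
    change Lam.xy q α * (Lam.xy q (q * α) * w) = 0
    rw [← mul_assoc, Lam.xy_mul_xy, zero_mul]

/-- The kernel is generated by x - αy, whose image is killed on the right by x - qαy and hence
equals c(x - αy); left multiplication by c is the extension. -/
theorem exists_extend_of_ker (hq0 : q ≠ 0) {α : k} {X : RightMod (Lam k q)}
    {p : Lam k q →ₗ[(Lam k q)ᵐᵒᵖ] X} (hp : ∀ u, p u = 0 ↔ ∃ w, u = Lam.xy q α * w)
    (f : LinearMap.ker p →ₗ[(Lam k q)ᵐᵒᵖ] Lam k q) :
    ∃ g : Lam k q →ₗ[(Lam k q)ᵐᵒᵖ] Lam k q, g ∘ₗ (LinearMap.ker p).subtype = f := by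
  let t : LinearMap.ker p := ⟨Lam.xy q α, (hp _).mpr ⟨1, (mul_one _).symm⟩⟩
  have ht : f t * Lam.xy q (q * α) = 0 := by
    have : op (Lam.xy q (q * α)) • t = 0 := Subtype.ext (Lam.xy_mul_xy α)
    exact (f.map_smul (op (Lam.xy q (q * α))) t).symm.trans (by rw [this, map_zero])
  obtain ⟨c, hc⟩ := Lam.exists_eq_mul_xy hq0 α ht
  refine ⟨{ toFun := fun w => c * w
            map_add' := mul_add _
            map_smul' := fun a w => (mul_assoc _ w a.unop).symm }, ?_⟩
  ext ⟨u, hu⟩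
  obtain ⟨w, rfl⟩ := (hp u).mp hu
  have h : c * (Lam.xy q α * w) = f t * w := by rw [hc, mul_assoc]
  exact h.trans (f.map_smul (op w) t).symm

theorem subsingleton_ext_of_isPresentedBy (hq0 : q ≠ 0) (hq : ¬ IsOfFinOrder q) (i n : ℕ)
    {X : RightMod (Lam k q)} (hX : IsPresentedBy (q ^ (n + 1)) X) :
    Subsingleton (Ext.{u} X (ModuleCat.of (Lam k q)ᵐᵒᵖ (Lam k q)) (i + 1)) := by
  have := projective_right_self (Lam k q)
  induction i generalizing n X with
  | zero =>
    obtain ⟨p, hp, hker⟩ := hX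
    have : Projective p.shortComplexKer.X₂ :=
      (ModuleCat.of (Lam k q)ᵐᵒᵖ (Lam k q)).projective_of_categoryTheory_projective
    refine subsingleton_ext_one_of_shortExact (LinearMap.shortExact_shortComplexKer hp) _ fun f => ?_
    obtain ⟨g, hg⟩ := exists_extend_of_ker hq0 hker f.hom
    exact ⟨ModuleCat.ofHom g, ModuleCat.hom_ext hg⟩
  | succ i ih =>
    obtain ⟨p, hp, hker⟩ := hX
    have : Projective p.shortComplexKer.X₂ :=
      (ModuleCat.of (Lam k q)ᵐᵒᵖ (Lam k q)).projective_of_categoryTheory_projective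
    have hK := isPresentedBy_ker (pow_succ_ne_one hq n)
      (by rw [← pow_succ']; exact pow_succ_ne_one hq (n + 1)) hker
    rw [← pow_succ'] at hK
    have : Subsingleton (Ext.{u} p.shortComplexKer.X₁ (ModuleCat.of (Lam k q)ᵐᵒᵖ (Lam k q))
      (i + 1)) := ih (n + 1) hK
    exact subsingleton_ext_succ_of_shortExact (LinearMap.shortExact_shortComplexKer hp) _ (i + 1)

theorem RZ.op_smul_v (α : k) (u : Lam k q) :
    op u • RZ.v q α = (![u.coord 0, α * u.coord 1 + u.coord 2, u.coord 3] : Fin 3 → k) := by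
  rw [RZ.op_smul, ← Lam.mk_coord u, Lam.coord_mk]
  simp only [Lam.mk, map_add, map_smul, map_mul, map_one, rep_g, genMatrix_mul]
  funext i
  fin_cases i <;>
    simp [RZ.v, genMatrix, Matrix.vecMul, dotProduct, Fin.sum_univ_three, mul_comm]

theorem isPresentedBy_modM {α : k} (hα : α ≠ 1) : IsPresentedBy α (modM k q α) := by
  refine ⟨{ toFun := fun u => op u • RZ.v q α
            map_add' := fun u w => by rw [MulOpposite.op_add, add_smul]
            map_smul' := fun a u => mul_smul a (op u) (RZ.v q α) }, fun m => ?_, fun u => ?_⟩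
  · refine ⟨Lam.mk q ![m 0, 0, m 1, m 2, 0, 0], (RZ.op_smul_v α _).trans ?_⟩
    funext i
    fin_cases i <;> simp [Lam.coord_mk]
  · change op u • RZ.v q α = 0 ↔ _
    constructor
    · intro h
      rw [RZ.op_smul_v] at h
      have h0 : u.coord 0 = 0 := congrFun h 0
      have h1 : α * u.coord 1 + u.coord 2 = 0 := congrFun h 1
      have h3 : u.coord 3 = 0 := congrFun h 2
      have hne : 1 - α ≠ 0 := sub_ne_zero.mpr hα.symm
      refine ⟨Lam.mk q ![u.coord 1, 0, u.coord 4, u.coord 5 * (1 - α)⁻¹, 0, 0],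
        Lam.coord_injective ?_⟩
      ext i
      fin_cases i <;> simp [Lam.coord_mul, Lam.coord_xy, mulCoord, Lam.coord_mk, h0, h3]
      · linear_combination h1
      · field_simp
        ring
    · rintro ⟨w, rfl⟩
      rw [op_mul, mul_smul, RZ.xy_smul_v, smul_zero]

theorem isSemiGorensteinProjective_modM (hq0 : q ≠ 0) (hq : ¬ IsOfFinOrder q) :
    IsSemiGorensteinProjective (modM k q q) := by
  intro i hi
  obtain ⟨i, rfl⟩ := Nat.exists_eq_add_of_le' hi
  have h1 := pow_succ_ne_one hq 0
  rw [zero_add, pow_one] at h1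
  refine subsingleton_ext_of_isPresentedBy hq0 hq i 0 ?_
  rw [zero_add, pow_one]
  exact isPresentedBy_modM h1

theorem RZ.finrank_eq (α : k) : Module.finrank k (RZ k q α) = 3 :=
  Module.finrank_fin_fun k

end Delooping

theorem mainTheorem1 (k : Type u) [Field k] (q : k) (hq0 : q ≠ 0) (hq : ¬ IsOfFinOrder q) :
    Module.finrank k (Delooping.Lam k q) = 6 ∧
      IsLocalRing (Delooping.Lam k q) ∧
      Module.finrank k (Delooping.RZ k q q) = 3 ∧
      Delooping.IsSemiGorensteinProjective (Delooping.modM k q q) ∧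
      Delooping.dell (Delooping.modM k q q) = ⊤ :=
  ⟨Delooping.Lam.finrank_eq, Delooping.Lam.isLocalRing, Delooping.RZ.finrank_eq q,
    Delooping.isSemiGorensteinProjective_modM hq0 hq, Delooping.dell_eq_top hq0 hq⟩
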